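/- Let $E$ be a complex Banach lattice, that is, $E=F+iF$ is the complexification of a real Banach lattice $F$, with modulus $|z|=\sup_{|c|=1}\operatorname{Re}(cz)$ and norm $\|z\|=\||z|\|$. Let $\widehat E$ be the nonstandard hull of $E$, realised as an ultrapower with respect to an arbitrary countably incomplete ultrafilter $\mathcal U$ on a set $I$: the space of bounded families $(x_i)_{i\in I}$ in $E$ modulo the families with $\lim_{\mathcal U}\|x_i\|=0$. It is a Banach lattice that contains $E$ (as the classes of constant families). Let $I(E)$ be the order ideal generated by $E$ in $\widehat E$, let $i_E=\overline{I(E)}$, and put $\widetilde E=\widehat E/E$ and $\check E=\widehat E/i_E$. Let $T\colon E\to E$ be a bounded linear operator that is AM-compact: for every $u\in E_+$ the image of the order interval $[-u,u]=\{z:|z|\le u\}$ under $T$ is contained in an order interval and is precompact. Let $\widehat T$ be the operator $[(x_i)]\mapsto[(Tx_i)]$ on $\widehat E$, and let $\widetilde T$ and $\check T$ be the operators that it induces on $\widetilde E$ and $\check E$. Let $\sigma_p$ denote the point spectrum (the set of eigenvalues), $\sigma$ the spectrum in the algebra of bounded operators, and $\sigma_{\rm ess}(T)$ the essential spectrum,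 i.e. the spectrum of the image of $T$ in the Calkin algebra (bounded operators on $E$ modulo compact operators). Then 1. $\sigma_p(\check T)\setminus\{0\}=\sigma_p(\widetilde T)\setminus\{0\}$; 2. for every $\lambda\in\mathbb C$ with $\lambda\ne0$, the operator $\lambda I-\check T$ is onto if and only if $\lambda I-\widetilde T$ is onto; 3. $\sigma(\check T)\setminus\{0\}=\sigma(\widetilde T)\setminus\{0\}=\sigma_{\rm ess}(T)\setminus\{0\}$. -/

import Mathlib

open Filter Topology
open scoped ENNReal

set_option linter.unusedSectionVars false

noncomputable section

namespace BanachLattice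

/-! ### Complex Banach lattices

A complex Banach lattice is the complexification `E = F + iF` of a real Banach lattice `F`, with
the modulus `|z| = sup {Re (c z) : |c| = 1}` (supremum in `F`) and the norm `‖z‖ = ‖|z|‖`. -/

/-- The complexification of a real vector space `F`; the pair `(x, y)` stands for `x + iy`. -/
def Cx (F : Type*) : Type _ := F × F

namespace Cx

variable {F : Type*}

/-- The real part. -/
def re (z : Cx F) : F := z.1

/-- The imaginary part. -/
def im (z : Cx F) : F := z.2

/-- The element `x + iy`. -/
def mk (x y : F) : Cx F := (x, y)

@[ext] theorem ext {z w : Cx F} (h₁ : z.re = w.re) (h₂ : z.im = w.im) : z = w := Prod.ext h₁ h₂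

@[simp] theorem re_mk (x y : F) : (mk x y).re = x := rfl
@[simp] theorem im_mk (x y : F) : (mk x y).im = y := rfl

instance [AddCommGroup F] : AddCommGroup (Cx F) := inferInstanceAs (AddCommGroup (F × F))

section Module

variable [AddCommGroup F]

@[simp] theorem re_zero : (0 : Cx F).re = 0 := rfl
@[simp] theorem im_zero : (0 : Cx F).im = 0 := rfl
@[simp] theorem re_add (z w : Cx F) : (z + w).re = z.re + w.re := rfl
@[simp] theorem im_add (z w : Cx F) : (z + w).im = z.im + w.im := rfl
@[simp] theorem re_neg (z : Cx F) : (-z).re = -z.re := rfl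
@[simp] theorem im_neg (z : Cx F) : (-z).im = -z.im := rfl
@[simp] theorem re_sub (z w : Cx F) : (z - w).re = z.re - w.re := rfl
@[simp] theorem im_sub (z w : Cx F) : (z - w).im = z.im - w.im := rfl

variable [Module ℝ F]

instance : SMul ℂ (Cx F) :=
  ⟨fun c z => mk (c.re • z.re - c.im • z.im) (c.re • z.im + c.im • z.re)⟩

@[simp] theorem re_smul (c : ℂ) (z : Cx F) : (c • z).re = c.re • z.re - c.im • z.im := rfl
@[simp] theorem im_smul (c : ℂ) (z : Cx F) : (c • z).im = c.re • z.im + c.im • z.re := rfl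

instance : Module ℂ (Cx F) where
  one_smul z := by ext <;> simp
  mul_smul c d z := by ext <;> simp <;> module
  smul_zero c := by ext <;> simp
  smul_add c z w := by ext <;> simp <;> module
  add_smul c d z := by ext <;> simp <;> module
  zero_smul z := by ext <;> simp

end Module

section Norm

variable [NormedAddCommGroup F] [Lattice F] [IsOrderedAddMonoid F] [HasSolidNorm F]
  [NormedSpace ℝ F] [IsOrderedModule ℝ F]

theorem smul_le_abs_smul_abs (a : ℝ) (x : F) : a • x ≤ |a| • |x| := by
  rcases le_total 0 a with h | h
  · rw [abs_of_nonneg h]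
    exact smul_le_smul_of_nonneg_left (le_abs_self x) h
  · rw [abs_of_nonpos h, ← neg_smul_neg]
    exact smul_le_smul_of_nonneg_left (neg_le_abs x) (neg_nonneg.2 h)

theorem smul_sup_of_nonneg {r : ℝ} (hr : 0 ≤ r) (x y : F) : r • (x ⊔ y) = r • x ⊔ r • y := by
  rcases hr.eq_or_lt with rfl | h
  · simp
  · exact (OrderIso.smulRight (β := F) h).map_sup x y

theorem re_smul_le (c : ℂ) (z : Cx F) : (c • z).re ≤ ‖c‖ • (|z.re| + |z.im|) := by
  have h1 : c.re • z.re ≤ ‖c‖ • |z.re| := (smul_le_abs_smul_abs _ _).trans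
    (smul_le_smul_of_nonneg_right (Complex.abs_re_le_norm c) (abs_nonneg _))
  have h2 : (-c.im) • z.im ≤ ‖c‖ • |z.im| := (smul_le_abs_smul_abs _ _).trans
    (smul_le_smul_of_nonneg_right (by rw [abs_neg]; exact Complex.abs_im_le_norm c) (abs_nonneg _))
  rw [re_smul, smul_add, sub_eq_add_neg, ← neg_smul]
  exact add_le_add h1 h2

/-- The supremum that defines the modulus exists in every Banach lattice. -/
theorem exists_isLUB [CompleteSpace F] (z : Cx F) :
    ∃ s : F, IsLUB (Set.range fun c : Circle => ((c : ℂ) • z).re) s := by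
  classical
  set f : Circle → F := fun c => ((c : ℂ) • z).re with hf
  set u : F := |z.re| + |z.im| with hu
  have hu0 : 0 ≤ u := add_nonneg (abs_nonneg _) (abs_nonneg _)
  have hlip : ∀ c d : Circle, f c ≤ f d + dist c d • u := by
    intro c d
    have h := re_smul_le ((c : ℂ) - d) z
    rw [sub_smul, re_sub] at h
    have : dist c d = ‖(c : ℂ) - d‖ := by rw [← dist_eq_norm]; rfl
    rw [this]
    exact sub_le_iff_le_add'.1 h
  let S : Finset Circle → F := fun A => (insert 1 A).sup' (Finset.insert_nonempty _ _) f
  have hmono : Monotone S := fun A B h =>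
    Finset.sup'_mono f (Finset.insert_subset_insert _ h) (Finset.insert_nonempty _ _)
  have hmem : ∀ c, f c ≤ S {c} := fun c => Finset.le_sup' f (by simp)
  have hnet : ∀ ε : ℝ, 0 < ε → ∃ A₀ : Finset Circle, ∀ A, S A ≤ S A₀ + ε • u := by
    intro ε hε
    obtain ⟨t, -, htf, ht⟩ := (isCompact_univ (X := Circle)).finite_cover_balls hε
    refine ⟨htf.toFinset, fun A => Finset.sup'_le _ _ fun c _ => ?_⟩
    have hc := ht (Set.mem_univ c)
    simp only [Set.mem_iUnion, Metric.mem_ball, exists_prop] at hc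
    obtain ⟨d, hd, hcd⟩ := hc
    refine (hlip c d).trans (add_le_add (Finset.le_sup' f (by simp [hd])) ?_)
    exact smul_le_smul_of_nonneg_right hcd.le hu0
  have hcauchy : CauchySeq S := by
    rw [Metric.cauchySeq_iff']
    intro ε hε
    obtain ⟨A₀, hA₀⟩ := hnet (ε / (‖u‖ + 1)) (by positivity)
    refine ⟨A₀, fun A hA => ?_⟩
    have h0 : 0 ≤ S A - S A₀ := sub_nonneg.2 (hmono hA)
    have h1 : S A - S A₀ ≤ (ε / (‖u‖ + 1)) • u := sub_le_iff_le_add'.2 (hA₀ A)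
    have h2 : ‖S A - S A₀‖ ≤ ‖(ε / (‖u‖ + 1)) • u‖ := by
      apply norm_le_norm_of_abs_le_abs
      rwa [abs_of_nonneg h0, abs_of_nonneg (h0.trans h1)]
    rw [dist_eq_norm]
    refine h2.trans_lt ?_
    rw [norm_smul, Real.norm_of_nonneg (by positivity), div_mul_eq_mul_div,
      div_lt_iff₀ (by positivity)]
    nlinarith [norm_nonneg u]
  obtain ⟨s, hs⟩ := cauchySeq_tendsto_of_complete hcauchy
  refine ⟨s, ?_, ?_⟩
  · rintro _ ⟨c, rfl⟩
    exact (hmem c).trans (hmono.ge_of_tendsto hs _)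
  · intro b hb
    exact le_of_tendsto' hs fun A => Finset.sup'_le _ _ fun c _ => hb ⟨c, rfl⟩

variable [CompleteSpace F]

/-- The modulus `|z| = sup {Re (c z) : |c| = 1}` of an element of a complex Banach lattice. -/
def modulus (z : Cx F) : F := (exists_isLUB z).choose

theorem isLUB_modulus (z : Cx F) :
    IsLUB (Set.range fun c : Circle => ((c : ℂ) • z).re) z.modulus := (exists_isLUB z).choose_spec

theorem re_smul_le_modulus (c : Circle) (z : Cx F) : ((c : ℂ) • z).re ≤ z.modulus :=
  (isLUB_modulus z).1 ⟨c, rfl⟩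

theorem modulus_le {z : Cx F} {b : F} (h : ∀ c : Circle, ((c : ℂ) • z).re ≤ b) : z.modulus ≤ b :=
  (isLUB_modulus z).2 (by rintro _ ⟨c, rfl⟩; exact h c)

theorem abs_re_le_modulus (z : Cx F) : |z.re| ≤ z.modulus := by
  have h1 := re_smul_le_modulus 1 z
  have h2 := re_smul_le_modulus (-1) z
  simp at h1 h2
  exact abs_le'.2 ⟨h1, h2⟩

theorem modulus_nonneg (z : Cx F) : 0 ≤ z.modulus := (abs_nonneg _).trans (abs_re_le_modulus z)

theorem modulus_le_add (z : Cx F) : z.modulus ≤ |z.re| + |z.im| :=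
  modulus_le fun c => by
    have h := re_smul_le (c : ℂ) z
    rwa [Circle.norm_coe, one_smul] at h

theorem modulus_circle_smul_le (c : Circle) (z : Cx F) : ((c : ℂ) • z).modulus ≤ z.modulus :=
  modulus_le fun d => by
    have := re_smul_le_modulus (d * c) z
    rwa [Circle.coe_mul, mul_smul] at this

theorem modulus_circle_smul (c : Circle) (z : Cx F) : ((c : ℂ) • z).modulus = z.modulus := by
  refine (modulus_circle_smul_le c z).antisymm ?_
  have := modulus_circle_smul_le c⁻¹ ((c : ℂ) • z)
  rwa [smul_smul, ← Circle.coe_mul, inv_mul_cancel, Circle.coe_one, one_smul] at this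

theorem abs_im_le_modulus (z : Cx F) : |z.im| ≤ z.modulus := by
  have hI : ((Circle.exp (Real.pi / 2) : Circle) : ℂ) = Complex.I := by
    rw [Circle.coe_exp]
    push_cast
    exact Complex.exp_pi_div_two_mul_I
  have h := abs_re_le_modulus (((Circle.exp (Real.pi / 2) : Circle) : ℂ) • z)
  rw [modulus_circle_smul, hI] at h
  simpa using h

theorem re_ofReal_smul (r : ℝ) (z : Cx F) : ((r : ℂ) • z).re = r • z.re := by
  rw [re_smul, Complex.ofReal_re, Complex.ofReal_im, zero_smul, sub_zero]

theorem modulus_ofReal_smul_le {r : ℝ} (hr : 0 ≤ r) (z : Cx F) :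
    ((r : ℂ) • z).modulus ≤ r • z.modulus :=
  modulus_le fun c => by
    rw [smul_comm, re_ofReal_smul]
    exact smul_le_smul_of_nonneg_left (re_smul_le_modulus c z) hr

theorem modulus_ofReal_smul {r : ℝ} (hr : 0 ≤ r) (z : Cx F) :
    ((r : ℂ) • z).modulus = r • z.modulus := by
  refine (modulus_ofReal_smul_le hr z).antisymm ?_
  rcases hr.eq_or_lt with rfl | h
  · simpa using modulus_nonneg _
  · have := modulus_ofReal_smul_le (inv_nonneg.2 hr) ((r : ℂ) • z)
    rw [smul_smul, ← Complex.ofReal_mul, inv_mul_cancel₀ h.ne', Complex.ofReal_one, one_smul] at this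
    have := smul_le_smul_of_nonneg_left this hr
    rwa [smul_smul, mul_inv_cancel₀ h.ne', one_smul] at this

theorem modulus_smul (c : ℂ) (z : Cx F) : (c • z).modulus = ‖c‖ • z.modulus := by
  have hc : c = ((Circle.exp c.arg : Circle) : ℂ) * (‖c‖ : ℂ) := by
    rw [Circle.coe_exp, mul_comm, Complex.norm_mul_exp_arg_mul_I]
  conv_lhs => rw [hc]
  rw [mul_smul, modulus_circle_smul, modulus_ofReal_smul (norm_nonneg _)]

theorem modulus_add_le (z w : Cx F) : (z + w).modulus ≤ z.modulus + w.modulus :=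
  modulus_le fun c => by
    rw [smul_add, re_add]
    exact add_le_add (re_smul_le_modulus c z) (re_smul_le_modulus c w)

instance : Norm (Cx F) := ⟨fun z => ‖z.modulus‖⟩

theorem norm_def (z : Cx F) : ‖z‖ = ‖z.modulus‖ := rfl

theorem normCore : NormedSpace.Core ℂ (Cx F) where
  norm_nonneg z := norm_nonneg z.modulus
  norm_smul c z := by rw [norm_def, modulus_smul, norm_smul, norm_norm]; rfl
  norm_triangle z w := by
    refine le_trans ?_ (norm_add_le z.modulus w.modulus)
    apply norm_le_norm_of_abs_le_abs
    rw [abs_of_nonneg (modulus_nonneg _),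
      abs_of_nonneg (add_nonneg (modulus_nonneg _) (modulus_nonneg _))]
    exact modulus_add_le z w
  norm_eq_zero_iff z := by
    rw [norm_def, norm_eq_zero]
    constructor
    · intro h
      have h1 := abs_re_le_modulus z
      have h2 := abs_im_le_modulus z
      rw [h] at h1 h2
      ext
      · exact le_antisymm ((le_abs_self _).trans h1) (neg_nonpos.1 ((neg_le_abs _).trans h1))
      · exact le_antisymm ((le_abs_self _).trans h2) (neg_nonpos.1 ((neg_le_abs _).trans h2))
    · rintro rfl
      refine le_antisymm ?_ (modulus_nonneg _)
      simpa using modulus_le_add (0 : Cx F)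

/-- The norm `‖z‖ = ‖|z|‖` of a complex Banach lattice. -/
instance : NormedAddCommGroup (Cx F) := NormedAddCommGroup.ofCore normCore

instance : NormedSpace ℂ (Cx F) := NormedSpace.ofCore normCore

theorem norm_re_le (z : Cx F) : ‖z.re‖ ≤ ‖z‖ := by
  rw [norm_def]
  apply norm_le_norm_of_abs_le_abs
  rw [abs_of_nonneg (modulus_nonneg z)]
  exact abs_re_le_modulus z

theorem norm_le_add (z : Cx F) : ‖z‖ ≤ ‖z.re‖ + ‖z.im‖ := by
  rw [norm_def, ← norm_abs_eq_norm z.re, ← norm_abs_eq_norm z.im]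
  refine le_trans (norm_le_norm_of_abs_le_abs ?_) (norm_add_le _ _)
  rw [abs_of_nonneg (modulus_nonneg _),
    abs_of_nonneg (add_nonneg (abs_nonneg _) (abs_nonneg _))]
  exact modulus_le_add z

end Norm

end Cx

/-! ### Nonstandard hulls (ultrapowers) -/

section Hull

variable (𝕜 : Type*) [NontriviallyNormedField 𝕜] {ι : Type*} (U : Ultrafilter ι)
  (X : Type*) [NormedAddCommGroup X] [NormedSpace 𝕜 X]

/-- The bounded families `(x i)` in `X` whose norm is infinitesimal, that is, `‖x i‖ → 0`
along `U`. -/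
def nullFamilies : Submodule 𝕜 (lp (fun _ : ι => X) ∞) where
  carrier := {x | Tendsto (fun i => x i) U (𝓝 0)}
  zero_mem' := by simp
  add_mem' {x y} hx hy := by simpa using Tendsto.add hx hy
  smul_mem' c x hx := by simpa using Tendsto.const_smul hx c

/-- The nonstandard hull `X̂`: bounded families modulo infinitesimal families, with the
quotient norm (which is the limit of `‖x i‖` along `U`). -/
abbrev Hull : Type _ := lp (fun _ : ι => X) ∞ ⧸ nullFamilies 𝕜 U X

variable {X}

theorem mem_nullFamilies {x : lp (fun _ : ι => X) ∞} :
    x ∈ nullFamilies 𝕜 U X ↔ Tendsto (fun i => x i) U (𝓝 0) := Iff.rfl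

variable (X) in
/-- Constant families. -/
def constFamily : X →ₗ[𝕜] lp (fun _ : ι => X) ∞ where
  toFun x := ⟨fun _ => x, memℓp_infty ⟨‖x‖, by rintro _ ⟨i, rfl⟩; rfl⟩⟩
  map_add' x y := rfl
  map_smul' c x := rfl

variable (X) in
/-- The canonical embedding of `X` into its nonstandard hull. -/
def toHull : X →ₗ[𝕜] Hull 𝕜 U X := (nullFamilies 𝕜 U X).mkQ ∘ₗ constFamily 𝕜 X

variable {𝕜} {Y : Type*} [NormedAddCommGroup Y] [NormedSpace 𝕜 Y]

/-- The operator `(x i) ↦ (T (x i))` on bounded families. -/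
def mapFamily (T : X →L[𝕜] Y) : lp (fun _ : ι => X) ∞ →L[𝕜] lp (fun _ : ι => Y) ∞ :=
  LinearMap.mkContinuous
    { toFun := fun x => ⟨fun i => T (x i), memℓp_infty ⟨‖T‖ * ‖x‖, by
        rintro _ ⟨i, rfl⟩
        exact T.le_of_opNorm_le_of_le le_rfl (lp.norm_apply_le_norm (by simp) x i)⟩⟩
      map_add' := fun x y => lp.ext (funext fun i => T.map_add (x i) (y i))
      map_smul' := fun c x => lp.ext (funext fun i => T.map_smul c (x i)) }
    ‖T‖ fun x => lp.norm_le_of_forall_le (by positivity) fun i =>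
      T.le_of_opNorm_le_of_le le_rfl (lp.norm_apply_le_norm (by simp) x i)

@[simp] theorem mapFamily_apply (T : X →L[𝕜] Y) (x : lp (fun _ : ι => X) ∞) (i : ι) :
    mapFamily T x i = T (x i) := rfl

/-- The operator `T̂` induced by `T` on the nonstandard hulls. -/
def hullMap (T : X →L[𝕜] Y) : Hull 𝕜 U X →L[𝕜] Hull 𝕜 U Y :=
  (nullFamilies 𝕜 U X).liftQL ((nullFamilies 𝕜 U Y).mkQL.comp (mapFamily T)) (by
    intro x hx
    have : mapFamily T x ∈ nullFamilies 𝕜 U Y := by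
      rw [mem_nullFamilies] at hx ⊢
      simpa [Function.comp_def] using (T.continuous.tendsto 0).comp hx
    simpa using this)

theorem hullMap_mk (T : X →L[𝕜] Y) (x : lp (fun _ : ι => X) ∞) :
    hullMap U T (Submodule.Quotient.mk x) = Submodule.Quotient.mk (mapFamily T x) := rfl

theorem hullMap_toHull (T : X →L[𝕜] Y) (x : X) :
    hullMap U T (toHull 𝕜 U X x) = toHull 𝕜 U Y (T x) := rfl

/-! ### The space `X̃ = X̂ / X` and the operator `T̃` -/

variable (𝕜 X) in
/-- The space `X̃ = X̂ / X`. -/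
abbrev Tilde : Type _ := Hull 𝕜 U X ⧸ LinearMap.range (toHull 𝕜 U X)

/-- The operator `T̃` induced by `T̂` on `X̃`. -/
def tildeMap (T : X →L[𝕜] X) : Tilde 𝕜 U X →L[𝕜] Tilde 𝕜 U X :=
  (LinearMap.range (toHull 𝕜 U X)).liftQL
    ((LinearMap.range (toHull 𝕜 U X)).mkQL.comp (hullMap U T)) (by
      rintro _ ⟨x, rfl⟩
      simp [hullMap_toHull])

end Hull

/-! ### The order of the nonstandard hull of a Banach lattice -/

section HullLattice

variable {ι : Type*} (U : Ultrafilter ι)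
variable {F : Type*} [NormedAddCommGroup F] [Lattice F] [IsOrderedAddMonoid F] [HasSolidNorm F]

/-- The pointwise supremum of two bounded families. -/
def supFamily (x y : lp (fun _ : ι => F) ∞) : lp (fun _ : ι => F) ∞ :=
  ⟨fun i => x i ⊔ y i, memℓp_infty ⟨‖x‖ + ‖y‖, by
    rintro _ ⟨i, rfl⟩
    exact (norm_sup_le_add _ _).trans (add_le_add (lp.norm_apply_le_norm (by simp) x i)
      (lp.norm_apply_le_norm (by simp) y i))⟩⟩

/-- The pointwise infimum of two bounded families. -/
def infFamily (x y : lp (fun _ : ι => F) ∞) : lp (fun _ : ι => F) ∞ :=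
  ⟨fun i => x i ⊓ y i, memℓp_infty ⟨‖x‖ + ‖y‖, by
    rintro _ ⟨i, rfl⟩
    exact (norm_inf_le_add _ _).trans (add_le_add (lp.norm_apply_le_norm (by simp) x i)
      (lp.norm_apply_le_norm (by simp) y i))⟩⟩

variable [NormedSpace ℝ F]

theorem mk_eq_mk_iff {x y : lp (fun _ : ι => F) ∞} :
    (Submodule.Quotient.mk x : Hull ℝ U F) = Submodule.Quotient.mk y ↔
      Tendsto (fun i => ‖x i - y i‖) U (𝓝 0) := by
  rw [Submodule.Quotient.eq, mem_nullFamilies, tendsto_zero_iff_norm_tendsto_zero]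
  rfl

instance : Max (Hull ℝ U F) :=
  ⟨Quotient.map₂ supFamily fun x x' hx y y' hy => by
    replace hx := (mk_eq_mk_iff U).1 (Quotient.sound hx)
    replace hy := (mk_eq_mk_iff U).1 (Quotient.sound hy)
    refine Quotient.exact ((mk_eq_mk_iff U).2 ?_)
    refine squeeze_zero (fun _ => norm_nonneg _) (fun i => ?_) (by simpa using hx.add hy)
    exact norm_sup_sub_sup_le_add_norm _ _ _ _⟩

instance : Min (Hull ℝ U F) :=
  ⟨Quotient.map₂ infFamily fun x x' hx y y' hy => by
    replace hx := (mk_eq_mk_iff U).1 (Quotient.sound hx)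
    replace hy := (mk_eq_mk_iff U).1 (Quotient.sound hy)
    refine Quotient.exact ((mk_eq_mk_iff U).2 ?_)
    refine squeeze_zero (fun _ => norm_nonneg _) (fun i => ?_) (by simpa using hx.add hy)
    exact norm_inf_sub_inf_le_add_norm _ _ _ _⟩

theorem mk_sup (x y : lp (fun _ : ι => F) ∞) :
    (Submodule.Quotient.mk x ⊔ Submodule.Quotient.mk y : Hull ℝ U F) =
      Submodule.Quotient.mk (supFamily x y) := rfl

theorem mk_inf (x y : lp (fun _ : ι => F) ∞) :
    (Submodule.Quotient.mk x ⊓ Submodule.Quotient.mk y : Hull ℝ U F) =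
      Submodule.Quotient.mk (infFamily x y) := rfl

/-- The lattice structure of the nonstandard hull of a real Banach lattice: suprema and infima are
those of representing families, and `a ≤ b` means `a ⊔ b = b`. -/
instance : Lattice (Hull ℝ U F) :=
  Lattice.mk'
    (by rintro ⟨x⟩ ⟨y⟩; exact congrArg _ (lp.ext (funext fun i => sup_comm _ _)))
    (by rintro ⟨x⟩ ⟨y⟩ ⟨z⟩; exact congrArg _ (lp.ext (funext fun i => sup_assoc _ _ _)))
    (by rintro ⟨x⟩ ⟨y⟩; exact congrArg _ (lp.ext (funext fun i => inf_comm _ _)))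
    (by rintro ⟨x⟩ ⟨y⟩ ⟨z⟩; exact congrArg _ (lp.ext (funext fun i => inf_assoc _ _ _)))
    (by rintro ⟨x⟩ ⟨y⟩; exact congrArg _ (lp.ext (funext fun i => sup_inf_self)))
    (by rintro ⟨x⟩ ⟨y⟩; exact congrArg _ (lp.ext (funext fun i => inf_sup_self)))

instance : IsOrderedAddMonoid (Hull ℝ U F) where
  add_le_add_left a b h c := by
    rw [← sup_eq_right] at h ⊢
    suffices e : (a + c) ⊔ (b + c) = (a ⊔ b) + c by rw [e, h]
    clear h
    obtain ⟨a, rfl⟩ := Submodule.Quotient.mk_surjective _ a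
    obtain ⟨b, rfl⟩ := Submodule.Quotient.mk_surjective _ b
    obtain ⟨c, rfl⟩ := Submodule.Quotient.mk_surjective _ c
    exact congrArg _ (lp.ext (funext fun i => (sup_add (a i) (b i) (c i)).symm))

theorem mk_le_mk {x y : lp (fun _ : ι => F) ∞} (h : ∀ i, x i ≤ y i) :
    (Submodule.Quotient.mk x : Hull ℝ U F) ≤ Submodule.Quotient.mk y := by
  rw [← sup_eq_right, mk_sup]
  exact congrArg _ (lp.ext (funext fun i => sup_eq_right.2 (h i)))

variable [IsOrderedModule ℝ F] [CompleteSpace F]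

/-- The real parts of a bounded family in the complexification. -/
def reFamily (x : lp (fun _ : ι => Cx F) ∞) : lp (fun _ : ι => F) ∞ :=
  ⟨fun i => (x i).re, memℓp_infty ⟨‖x‖, by
    rintro _ ⟨i, rfl⟩
    exact (Cx.norm_re_le _).trans (lp.norm_apply_le_norm (by simp) x i)⟩⟩

/-- The real part of an element of the nonstandard hull of a complex Banach lattice; it is an
element of the nonstandard hull of the underlying real Banach lattice. -/
def hullRe : Hull ℂ U (Cx F) → Hull ℝ U F :=
  Quotient.map reFamily fun x y h => by
    replace h := (Submodule.quotientRel_def _).1 h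
    rw [mem_nullFamilies, tendsto_zero_iff_norm_tendsto_zero] at h
    refine Quotient.exact ((mk_eq_mk_iff U).2 ?_)
    exact squeeze_zero (fun _ => norm_nonneg _) (fun i => Cx.norm_re_le (x i - y i)) h

theorem hullRe_mk (x : lp (fun _ : ι => Cx F) ∞) :
    hullRe U (Submodule.Quotient.mk x) = Submodule.Quotient.mk (reFamily x) := rfl

theorem hullRe_add (z w : Hull ℂ U (Cx F)) : hullRe U (z + w) = hullRe U z + hullRe U w := by
  obtain ⟨z, rfl⟩ := Submodule.Quotient.mk_surjective _ z
  obtain ⟨w, rfl⟩ := Submodule.Quotient.mk_surjective _ w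
  rfl

theorem hullRe_ofReal_smul (r : ℝ) (z : Hull ℂ U (Cx F)) :
    hullRe U ((r : ℂ) • z) = r • hullRe U z := by
  obtain ⟨z, rfl⟩ := Submodule.Quotient.mk_surjective _ z
  rw [← Submodule.Quotient.mk_smul, hullRe_mk, hullRe_mk, ← Submodule.Quotient.mk_smul]
  exact congrArg _ (lp.ext (funext fun i => Cx.re_ofReal_smul _ _))

/-- The relation `|z| ≤ a` for `z` in the nonstandard hull of a complex Banach lattice and `a` in
the nonstandard hull of the underlying real Banach lattice. As `|z|` is the supremum of the elements
`Re (c z)` with `|c| = 1`, it says that `a` is an upper bound of these elements. -/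
def HullModulusLE (z : Hull ℂ U (Cx F)) (a : Hull ℝ U F) : Prop :=
  ∀ c : Circle, hullRe U ((c : ℂ) • z) ≤ a

variable (F) in
/-- The order ideal `I(E)` generated by `E` in `Ê`: the elements `z` with `|z| ≤ u` for some
positive `u` in `E`. -/
def orderIdeal : Submodule ℂ (Hull ℂ U (Cx F)) where
  carrier := {z | ∃ u : F, 0 ≤ u ∧ HullModulusLE U z (toHull ℝ U F u)}
  zero_mem' := ⟨0, le_rfl, fun c => by
    rw [smul_zero, map_zero]
    exact le_of_eq rfl⟩
  add_mem' := by
    rintro z w ⟨u, hu, hz⟩ ⟨v, hv, hw⟩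
    refine ⟨u + v, add_nonneg hu hv, fun c => ?_⟩
    rw [smul_add, hullRe_add, map_add]
    exact add_le_add (hz c) (hw c)
  smul_mem' := by
    rintro c z ⟨u, hu, hz⟩
    refine ⟨‖c‖ • u, smul_nonneg (norm_nonneg _) hu, fun d => ?_⟩
    have hc : c = (‖c‖ : ℂ) * ((Circle.exp c.arg : Circle) : ℂ) := by
      rw [Circle.coe_exp, Complex.norm_mul_exp_arg_mul_I]
    have h := hz (d * Circle.exp c.arg)
    have e : (d : ℂ) • c • z = (‖c‖ : ℂ) • ((d * Circle.exp c.arg : Circle) : ℂ) • z := by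
      conv_lhs => rw [hc]
      rw [smul_smul, smul_smul, Circle.coe_mul]
      congr 1
      ring
    rw [e, hullRe_ofReal_smul, map_smul]
    generalize hullRe U (((d * Circle.exp c.arg : Circle) : ℂ) • z) = a at h
    obtain ⟨a, rfl⟩ := Submodule.Quotient.mk_surjective _ a
    have h' := sup_eq_right.2 h
    rw [← sup_eq_right]
    suffices e : ‖c‖ • Submodule.Quotient.mk a ⊔ ‖c‖ • toHull ℝ U F u =
        ‖c‖ • (Submodule.Quotient.mk a ⊔ toHull ℝ U F u) by rw [e, h']
    refine congrArg _ (lp.ext (funext fun i => ?_))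
    exact (Cx.smul_sup_of_nonneg (norm_nonneg c) (a i) u).symm

variable (F) in
/-- The closed order ideal `i_E`, the closure of `I(E)` in `Ê`. -/
def closedOrderIdeal : Submodule ℂ (Hull ℂ U (Cx F)) := (orderIdeal U F).topologicalClosure

variable (F) in
/-- The space `Ě = Ê / i_E`. -/
abbrev Check : Type _ := Hull ℂ U (Cx F) ⧸ closedOrderIdeal U F

end HullLattice

/-! ### Order bounded operators, AM-compact operators, and the operator `Ť` -/

section Operators

variable {F : Type*} [NormedAddCommGroup F] [Lattice F] [IsOrderedAddMonoid F] [HasSolidNorm F]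
  [NormedSpace ℝ F] [IsOrderedModule ℝ F] [CompleteSpace F]

variable (F) in
/-- The order interval `[-u, u] = {z : |z| ≤ u}` of a complex Banach lattice. -/
def orderInterval (u : F) : Set (Cx F) := {z | z.modulus ≤ u}

/-- Order bounded operators: order intervals are mapped into order intervals. -/
def IsOrderBoundedOperator (T : Cx F →L[ℂ] Cx F) : Prop :=
  ∀ u : F, 0 ≤ u → ∃ v : F, 0 ≤ v ∧ T '' orderInterval F u ⊆ orderInterval F v

/-- AM-compact operators: order bounded operators that map order intervals to precompact sets. -/
structure IsAMCompact (T : Cx F →L[ℂ] Cx F) : Prop where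
  orderBounded : IsOrderBoundedOperator T
  totallyBounded : ∀ u : F, 0 ≤ u → TotallyBounded (T '' orderInterval F u)

variable {ι : Type*} (U : Ultrafilter ι)

/-- The truncation of `x` to the order interval `[-u, u]`. -/
def clip (u x : F) : F := (x ⊓ u) ⊔ (-u)

theorem abs_clip_le {u : F} (hu : 0 ≤ u) (x : F) : |clip u x| ≤ u := by
  refine abs_le'.2 ⟨sup_le inf_le_right ((neg_nonpos.2 hu).trans hu), ?_⟩
  rw [neg_le]
  exact le_sup_right

theorem norm_sub_clip_le (u x : F) :
    ‖x - clip u x‖ ≤ ‖x ⊔ u - u‖ + ‖-x ⊔ u - u‖ := by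
  have h1 : 0 ≤ x ⊔ u - u := sub_nonneg.2 le_sup_right
  have h2 : 0 ≤ -x ⊔ u - u := sub_nonneg.2 le_sup_right
  refine le_trans (norm_le_norm_of_abs_le_abs ?_) (norm_add_le _ _)
  rw [abs_of_nonneg (add_nonneg h1 h2)]
  have e : x ⊓ u = x - (x ⊔ u - u) := by
    have := inf_add_sup x u
    rw [eq_sub_iff_add_eq, ← add_sub_assoc, this, add_sub_cancel_right]
  refine abs_le'.2 ⟨?_, ?_⟩
  · have : x ⊓ u ≤ clip u x := le_sup_left
    rw [e] at this
    exact (sub_le_comm.1 this).trans (le_add_of_nonneg_right h2)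
  · rw [neg_sub, sub_le_iff_le_add]
    refine sup_le (inf_le_left.trans (le_add_of_nonneg_left (add_nonneg h1 h2))) ?_
    have h3 : -x ≤ -x ⊔ u := le_sup_left
    have h4 : -u ≤ (-x ⊔ u - u) + x := by
      rw [sub_add_eq_add_sub, le_sub_iff_add_le, neg_add_cancel]
      exact neg_le_iff_add_nonneg.1 h3
    refine h4.trans ?_
    gcongr
    exact le_add_of_nonneg_left h1

theorem tendsto_of_le_toHull {u : F} {x : lp (fun _ : ι => F) ∞}
    (h : (Submodule.Quotient.mk x : Hull ℝ U F) ≤ toHull ℝ U F u) :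
    Tendsto (fun i => ‖x i ⊔ u - u‖) U (𝓝 0) :=
  (mk_eq_mk_iff (x := supFamily x (constFamily ℝ F u)) (y := constFamily ℝ F u) U).1
    (sup_eq_right.2 h)

/-- The family obtained by truncating real and imaginary parts. -/
def clipFamily {u : F} (hu : 0 ≤ u) (x : lp (fun _ : ι => Cx F) ∞) : lp (fun _ : ι => Cx F) ∞ :=
  ⟨fun i => Cx.mk (clip u (x i).re) (clip u (x i).im), memℓp_infty ⟨‖u‖ + ‖u‖, by
    rintro _ ⟨i, rfl⟩
    refine (Cx.norm_le_add _).trans (add_le_add ?_ ?_) <;>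
    · apply norm_le_norm_of_abs_le_abs
      rw [abs_of_nonneg hu]
      exact abs_clip_le hu _⟩⟩

theorem mk_clipFamily {u : F} (hu : 0 ≤ u) (x : lp (fun _ : ι => Cx F) ∞)
    (hx : HullModulusLE U (Submodule.Quotient.mk x) (toHull ℝ U F u)) :
    (Submodule.Quotient.mk x : Hull ℂ U (Cx F)) = Submodule.Quotient.mk (clipFamily hu x) := by
  have key : ∀ c : Circle, Tendsto (fun i => ‖((c : ℂ) • x i).re ⊔ u - u‖) U (𝓝 0) := fun c =>
    tendsto_of_le_toHull U (x := reFamily ((c : ℂ) • x)) (hx c)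
  have hI : ((Circle.exp (Real.pi / 2) : Circle) : ℂ) = Complex.I := by
    rw [Circle.coe_exp]
    push_cast
    exact Complex.exp_pi_div_two_mul_I
  have k1 := key 1
  have k2 := key (-1)
  have k3 := key (-Circle.exp (Real.pi / 2))
  have k4 := key (Circle.exp (Real.pi / 2))
  simp [hI] at k1 k2 k3 k4
  rw [Submodule.Quotient.eq, mem_nullFamilies, tendsto_zero_iff_norm_tendsto_zero]
  refine squeeze_zero (fun _ => norm_nonneg _) (fun i => ?_)
    (by simpa using (k1.add k2).add (k3.add k4))
  exact (Cx.norm_le_add (x i - clipFamily hu x i)).trans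
    (add_le_add (norm_sub_clip_le u (x i).re) (norm_sub_clip_le u (x i).im))

theorem hullMap_mem_orderIdeal {T : Cx F →L[ℂ] Cx F} (hT : IsOrderBoundedOperator T)
    {z : Hull ℂ U (Cx F)} (hz : z ∈ orderIdeal U F) : hullMap U T z ∈ orderIdeal U F := by
  obtain ⟨u, hu, hz⟩ := hz
  obtain ⟨x, rfl⟩ := Submodule.Quotient.mk_surjective _ z
  obtain ⟨v, hv, huv⟩ := hT (u + u) (add_nonneg hu hu)
  refine ⟨v, hv, ?_⟩
  rw [mk_clipFamily U hu x hz, hullMap_mk]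
  intro c
  refine mk_le_mk U fun i => (Cx.re_smul_le_modulus c _).trans (huv ⟨_, ?_, rfl⟩)
  exact (Cx.modulus_le_add _).trans (add_le_add (abs_clip_le hu _) (abs_clip_le hu _))

theorem hullMap_mem_closedOrderIdeal {T : Cx F →L[ℂ] Cx F} (hT : IsOrderBoundedOperator T)
    {z : Hull ℂ U (Cx F)} (hz : z ∈ closedOrderIdeal U F) :
    hullMap U T z ∈ closedOrderIdeal U F :=
  map_mem_closure (hullMap U T).continuous hz fun _ h => hullMap_mem_orderIdeal U hT h

/-- The operator `Ť` induced by `T̂` on `Ě`, for an order bounded operator `T`. -/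
def checkMap (T : Cx F →L[ℂ] Cx F) (hT : IsOrderBoundedOperator T) : Check U F →L[ℂ] Check U F :=
  (closedOrderIdeal U F).liftQL ((closedOrderIdeal U F).mkQL.comp (hullMap U T)) (by
    intro z hz
    simpa using hullMap_mem_closedOrderIdeal U hT hz)

end Operators

/-! ### Spectra -/

section Spectra

variable {X : Type*} [AddCommGroup X] [Module ℂ X] [TopologicalSpace X]

/-- The point spectrum: the set of eigenvalues. -/
def pointSpectrum (T : X →L[ℂ] X) : Set ℂ := {c | Module.End.HasEigenvalue (T : X →ₗ[ℂ] X) c}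

end Spectra

section Essential

variable (X : Type*) [NormedAddCommGroup X] [NormedSpace ℂ X]

/-- The ideal of compact operators in the algebra of bounded operators. -/
def compactIdeal : Ideal (X →L[ℂ] X) where
  carrier := {T | IsCompactOperator T}
  zero_mem' := isCompactOperator_zero
  add_mem' hS hT := hS.add hT
  smul_mem' S _ hT := hT.clm_comp S

instance : (compactIdeal X).IsTwoSided := ⟨fun S hT => IsCompactOperator.comp_clm hT S⟩

/-- The Calkin algebra. -/
abbrev Calkin : Type _ := (X →L[ℂ] X) ⧸ compactIdeal X

variable {X}

/-- The essential spectrum of `T`: the spectrum of the image of `T` in the Calkin algebra. -/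
def essentialSpectrum (T : X →L[ℂ] X) : Set ℂ :=
  spectrum ℂ (Ideal.Quotient.mk (compactIdeal X) T : Calkin X)

end Essential

end BanachLattice

end

noncomputable section
namespace BanachLattice

/-! ### Commuting factors and nonzero spectral values -/

section Commute

variable {X Y : Type*} [AddCommGroup X] [Module ℂ X] [TopologicalSpace X]
  [AddCommGroup Y] [Module ℂ Y] [TopologicalSpace Y]

/-! The operators `T̃` and `Ť` are the two products `S q` and `q S` of one pair of maps. Since `E`
lies in `i_E`, there is a quotient map `q : Ẽ → Ě` (`tildeToCheck`). Since `T` is AM-compact, `T̂`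
maps `i_E` into `E`, so it induces `S : Ě → Ẽ` (`checkToTilde`). Indeed an element of `I(E)` is
represented by a family in one order interval, whose image under `T` is precompact and so converges
along `U`; as `E` is closed in `Ê`, the closure `i_E` is also mapped into `E`
(`hullMap_mem_range_toHull`). Products in opposite orders share nonzero eigenvalues, surjectivity of
`c - ·` for `c ≠ 0`, and nonzero spectrum.

The essential spectrum enters through `isUnit_tildeMap_iff`. The map `A ↦ Ã` is multiplicative and
kills compact operators, so invertibility modulo compacts makes `Ã` invertible. Conversely,
countable incompleteness gives `f : ι → ℕ` tending to infinity along `U`, which turns bounded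
sequences into bounded families. Injectivity of `Ã` then gives a finite-dimensional kernel and
closed range, surjectivity gives finite codimension, and so `A` is Fredholm. -/

theorem pointSpectrum_comp_diff_zero_subset (q : X →L[ℂ] Y) (S : Y →L[ℂ] X) :
    pointSpectrum (S.comp q) \ {0} ⊆ pointSpectrum (q.comp S) \ {0} := by
  rintro c ⟨hc, hc0⟩
  refine ⟨?_, hc0⟩
  obtain ⟨v, hv⟩ := Module.End.HasEigenvalue.exists_hasEigenvector hc
  have hv1 : S (q v) = c • v := hv.apply_eq_smul
  -- The vector `q v` is nonzero because `S` maps it to `c • v ≠ 0`.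
  refine Module.End.hasEigenvalue_of_hasEigenvector (x := q v) ⟨?_, fun h => ?_⟩
  · rw [Module.End.mem_eigenspace_iff]
    change q (S (q v)) = c • q v
    rw [hv1, map_smul]
  · rw [h, map_zero] at hv1
    exact (smul_ne_zero hc0 hv.2) hv1.symm

theorem pointSpectrum_comp_diff_zero (q : X →L[ℂ] Y) (S : Y →L[ℂ] X) :
    pointSpectrum (S.comp q) \ {0} = pointSpectrum (q.comp S) \ {0} :=
  (pointSpectrum_comp_diff_zero_subset q S).antisymm (pointSpectrum_comp_diff_zero_subset S q)

variable [IsTopologicalAddGroup X] [ContinuousConstSMul ℂ X]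
  [IsTopologicalAddGroup Y] [ContinuousConstSMul ℂ Y]

theorem surjective_smul_id_sub_comp (q : X →L[ℂ] Y) (S : Y →L[ℂ] X) {c : ℂ} (hc : c ≠ 0)
    (h : Function.Surjective (c • ContinuousLinearMap.id ℂ Y - q.comp S)) :
    Function.Surjective (c • ContinuousLinearMap.id ℂ X - S.comp q) := by
  intro x
  obtain ⟨y, hy⟩ := h (q x)
  have hy' : c • y = q x + q (S y) := by
    rw [← hy]
    simp
  -- From `c y = q x + q S y` it follows that `S q (x + S y) = c S y`, so `c - S q` sends this
  -- vector to `x + S y - S y`.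
  refine ⟨c⁻¹ • (x + S y), ?_⟩
  have : S (q (x + S y)) = c • S y := by rw [map_add, ← hy', map_smul]
  change c • c⁻¹ • (x + S y) - S (q (c⁻¹ • (x + S y))) = x
  rw [map_smul, map_smul, this, smul_inv_smul₀ hc, inv_smul_smul₀ hc, add_sub_cancel_right]

theorem surjective_smul_id_sub_comp_iff (q : X →L[ℂ] Y) (S : Y →L[ℂ] X) {c : ℂ} (hc : c ≠ 0) :
    Function.Surjective (c • ContinuousLinearMap.id ℂ Y - q.comp S) ↔
      Function.Surjective (c • ContinuousLinearMap.id ℂ X - S.comp q) :=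
  ⟨surjective_smul_id_sub_comp q S hc, surjective_smul_id_sub_comp S q hc⟩

theorem spectrum_comp_diff_zero_subset (q : X →L[ℂ] Y) (S : Y →L[ℂ] X) :
    spectrum ℂ (S.comp q) \ {0} ⊆ spectrum ℂ (q.comp S) \ {0} := by
  rintro c ⟨hc, hc0 : c ≠ 0⟩
  refine ⟨fun hu => hc ?_, hc0⟩
  change IsUnit _ at hu ⊢
  rw [Algebra.algebraMap_eq_smul_one] at hu ⊢
  obtain ⟨R, hR1, hR2⟩ := isUnit_iff_exists.1 hu
  have h1 : ∀ y, c • R y - q (S (R y)) = y := fun y => by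
    simpa using congrArg (fun L : Y →L[ℂ] Y => L y) hR1
  have h2 : ∀ y, c • R y - R (q (S y)) = y := fun y => by
    simpa using congrArg (fun L : Y →L[ℂ] Y => L y) hR2
  -- The resolvent identity `(c - S q)⁻¹ = c⁻¹ (1 + S (c - q S)⁻¹ q)`.
  refine isUnit_iff_exists.2 ⟨c⁻¹ • (1 + S.comp (R.comp q)), ?_, ?_⟩
  · ext x
    have h : S (q (S (R (q x)))) = c • S (R (q x)) - S (q x) := by
      rw [← map_smul, ← map_sub]
      exact congrArg S (by rw [eq_sub_iff_add_eq, ← eq_sub_iff_add_eq', h1])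
    simp [h, smul_sub, smul_inv_smul₀ hc0, inv_smul_smul₀ hc0]
  · ext x
    have h : S (R (q (S (q x)))) = c • S (R (q x)) - S (q x) := by
      rw [← map_smul, ← map_sub]
      exact congrArg S (by rw [eq_sub_iff_add_eq, ← eq_sub_iff_add_eq', h2])
    simp [h, smul_sub, inv_smul_smul₀ hc0]

theorem spectrum_comp_diff_zero (q : X →L[ℂ] Y) (S : Y →L[ℂ] X) :
    spectrum ℂ (S.comp q) \ {0} = spectrum ℂ (q.comp S) \ {0} :=
  (spectrum_comp_diff_zero_subset q S).antisymm (spectrum_comp_diff_zero_subset S q)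

end Commute

/-! ### Convergent families -/

section Convergence

variable {𝕜 : Type*} [NontriviallyNormedField 𝕜] {ι : Type*} (U : Ultrafilter ι)
  {X : Type*} [NormedAddCommGroup X] [NormedSpace 𝕜 X]

/-- The dictionary for all that follows: lying in `X`, or vanishing in `X̃`, means convergence along
`U`. -/
theorem mk_mem_range_toHull_iff {x : lp (fun _ : ι => X) ∞} :
    (Submodule.Quotient.mk x : Hull 𝕜 U X) ∈ LinearMap.range (toHull 𝕜 U X) ↔
      ∃ y, Tendsto (fun i => x i) U (𝓝 y) := by
  refine exists_congr fun y => ?_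
  change (Submodule.Quotient.mk (constFamily 𝕜 X y) : Hull 𝕜 U X) = _ ↔ _
  rw [eq_comm, Submodule.Quotient.eq, mem_nullFamilies]
  exact tendsto_sub_nhds_zero_iff (u := fun i => x i)

theorem mk_mk_eq_zero_iff {x : lp (fun _ : ι => X) ∞} :
    (Submodule.Quotient.mk (Submodule.Quotient.mk x : Hull 𝕜 U X) : Tilde 𝕜 U X) = 0 ↔
      ∃ y, Tendsto (fun i => x i) U (𝓝 y) := by
  rw [Submodule.Quotient.mk_eq_zero, mk_mem_range_toHull_iff]

/-- The image of `U` is an ultrafilter on a totally bounded set, hence Cauchy. This is the source of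
limits for both compact and AM-compact operators. -/
theorem exists_tendsto_of_totallyBounded [CompleteSpace X] {s : Set X} (hs : TotallyBounded s)
    {x : ι → X} (hx : ∀ i, x i ∈ s) : ∃ y, Tendsto x U (𝓝 y) := by
  have h := totallyBounded_iff_ultrafilter.1 hs (U.map x)
    (le_principal_iff.2 (Filter.mem_map.2 (Filter.univ_mem' hx)))
  exact cauchy_iff_exists_le_nhds.1 h

variable (𝕜 X) in
-- Pulled back to bounded families, the claim is that a uniform limit of families converging along
-- `U` is Cauchy along `U`.
theorem isClosed_range_toHull [CompleteSpace X] :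
    IsClosed (LinearMap.range (toHull 𝕜 U X) : Set (Hull 𝕜 U X)) := by
  have hq : IsQuotientMap (Submodule.Quotient.mk : _ → Hull 𝕜 U X) := isQuotientMap_quot_mk
  rw [← hq.isClosed_preimage]
  refine isClosed_of_closure_subset fun x hx => ?_
  refine (mk_mem_range_toHull_iff U).2 (cauchy_map_iff_exists_tendsto.1 ?_)
  refine Metric.cauchy_iff.2 ⟨inferInstance, fun ε hε => ?_⟩
  obtain ⟨z, hz, hxz⟩ := Metric.mem_closure_iff.1 hx (ε / 4) (by positivity)
  obtain ⟨y, hy⟩ := (mk_mem_range_toHull_iff U).1 hz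
  refine ⟨Metric.ball y (ε / 2), ?_, fun a ha b hb => ?_⟩
  · have hz' : ∀ᶠ i in (U : Filter ι), z i ∈ Metric.ball y (ε / 4) :=
      hy (Metric.ball_mem_nhds y (by positivity))
    refine Filter.mem_map.2 ?_
    filter_upwards [hz'] with i hi
    have h1 : dist (x i) (z i) ≤ dist x z := by
      rw [dist_eq_norm, dist_eq_norm]
      exact lp.norm_apply_le_norm (by simp) (x - z) i
    have h2 : dist (z i) y < ε / 4 := hi
    exact Metric.mem_ball.2 (by linarith [dist_triangle (x i) (z i) y])
  · linarith [dist_triangle_right a b y, Metric.mem_ball.1 ha, Metric.mem_ball.1 hb]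

theorem exists_tendsto_atTop_of_not_countableInterFilter {U : Ultrafilter ι}
    (hU : ¬ CountableInterFilter (U : Filter ι)) : ∃ f : ι → ℕ, Tendsto f U atTop := by
  have h : ∃ s : ℕ → Set ι, (∀ n, s n ∈ U) ∧ (⋂ n, s n) ∉ U := by
    by_contra! h
    refine hU ⟨fun S hS hSU => ?_⟩
    rcases S.eq_empty_or_nonempty with rfl | hne
    · simp
    obtain ⟨s, rfl⟩ := hS.exists_eq_range hne
    rw [Set.sInter_range]
    exact h s fun n => hSU _ ⟨n, rfl⟩
  obtain ⟨s, hs, hs'⟩ := h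
  -- The first `n` with `i ∉ s n`. If there is none, `sInf ∅ = 0`, but this happens only on `⋂ n, s
  -- n`, which is not in `U`.
  refine ⟨fun i => sInf {n | i ∉ s n}, tendsto_atTop.2 fun N => ?_⟩
  have h1 : ∀ᶠ i in (U : Filter ι), ∀ n ∈ Finset.range N, i ∈ s n :=
    (Filter.eventually_all_finset _).2 fun n _ => hs n
  have h2 : ∀ᶠ i in (U : Filter ι), i ∈ (⋂ n, s n)ᶜ := Ultrafilter.compl_mem_iff_notMem.2 hs'
  filter_upwards [h1, h2] with i hi1 hi2
  simp only [Set.mem_compl_iff, Set.mem_iInter, not_forall] at hi2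
  refine le_csInf hi2 fun n hn => ?_
  by_contra! hlt
  exact hn (hi1 n (Finset.mem_range.2 hlt))

/-- As `f` is unbounded on every set of `U`, a limit would place two terms of `g` with different
indices in a ball of radius `1 / 2`. -/
theorem not_tendsto_of_pairwise_one_le_norm_sub {f : ι → ℕ} (hf : Tendsto f U atTop) {g : ℕ → X}
    (hg : Pairwise fun m n => 1 ≤ ‖g m - g n‖) (y : X) : ¬ Tendsto (fun i => g (f i)) U (𝓝 y) := by
  intro h
  have h1 := h (Metric.ball_mem_nhds y (by norm_num : (0 : ℝ) < 1 / 2))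
  obtain ⟨i, hi⟩ := (U.nonempty_of_mem h1)
  obtain ⟨j, hj, hij⟩ := U.nonempty_of_mem (inter_mem h1 (hf.eventually_gt_atTop (f i)))
  have h2 := hg (ne_of_gt hij)
  have h3 := dist_triangle_right (g (f j)) (g (f i)) y
  rw [dist_eq_norm] at h3
  have h4 : dist (g (f i)) y < 1 / 2 := hi
  have h5 : dist (g (f j)) y < 1 / 2 := hj
  linarith

/-- The bounded family `(g (f i))` obtained from a bounded sequence `g`. -/
def seqFamily (f : ι → ℕ) (g : ℕ → X) {C : ℝ} (hg : ∀ n, ‖g n‖ ≤ C) : lp (fun _ : ι => X) ∞ :=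
  ⟨fun i => g (f i), memℓp_infty ⟨C, by
    rintro _ ⟨i, rfl⟩
    exact hg _⟩⟩

end Convergence

/-! ### Functoriality of the operator `T̃` -/

section TildeMap

variable {𝕜 : Type*} [NontriviallyNormedField 𝕜] {ι : Type*} (U : Ultrafilter ι)
  {X : Type*} [NormedAddCommGroup X] [NormedSpace 𝕜 X]

theorem tilde_ext {A B : Tilde 𝕜 U X →L[𝕜] Tilde 𝕜 U X}
    (h : ∀ x : lp (fun _ : ι => X) ∞,
      A (Submodule.Quotient.mk (Submodule.Quotient.mk x)) =
        B (Submodule.Quotient.mk (Submodule.Quotient.mk x))) : A = B := by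
  ext z
  obtain ⟨z, rfl⟩ := Submodule.Quotient.mk_surjective _ z
  obtain ⟨x, rfl⟩ := Submodule.Quotient.mk_surjective _ z
  exact h x

theorem tildeMap_mk_mk (T : X →L[𝕜] X) (x : lp (fun _ : ι => X) ∞) :
    tildeMap U T (Submodule.Quotient.mk (Submodule.Quotient.mk x)) =
      Submodule.Quotient.mk (Submodule.Quotient.mk (mapFamily T x)) := rfl

theorem tildeMap_one : tildeMap U (1 : X →L[𝕜] X) = 1 := tilde_ext U fun _ => rfl

theorem tildeMap_mul (S T : X →L[𝕜] X) : tildeMap U (S * T) = tildeMap U S * tildeMap U T :=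
  tilde_ext U fun _ => rfl

theorem tildeMap_sub (S T : X →L[𝕜] X) : tildeMap U (S - T) = tildeMap U S - tildeMap U T :=
  tilde_ext U fun _ => rfl

theorem tildeMap_smul (c : 𝕜) (T : X →L[𝕜] X) : tildeMap U (c • T) = c • tildeMap U T :=
  tilde_ext U fun _ => rfl

theorem tildeMap_algebraMap_sub (c : 𝕜) (T : X →L[𝕜] X) :
    tildeMap U (algebraMap 𝕜 (X →L[𝕜] X) c - T) = algebraMap 𝕜 _ c - tildeMap U T := by
  rw [tildeMap_sub, Algebra.algebraMap_eq_smul_one, tildeMap_smul, tildeMap_one,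
    Algebra.algebraMap_eq_smul_one]

/-- A compact operator sends a bounded family into a compact set, where it converges along `U`. -/
theorem tildeMap_eq_zero [CompleteSpace X] {K : X →L[𝕜] X} (hK : IsCompactOperator K) :
    tildeMap U K = 0 := by
  refine tilde_ext U fun x => ?_
  rw [tildeMap_mk_mk, zero_apply, mk_mk_eq_zero_iff]
  obtain ⟨s, hs, hsub⟩ := IsCompactOperator.image_closedBall_subset_compact (f := (K : X →ₗ[𝕜] X))
    hK ‖x‖
  refine exists_tendsto_of_totallyBounded U hs.totallyBounded fun i => hsub ⟨x i, ?_, rfl⟩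
  rw [mem_closedBall_zero_iff]
  exact lp.norm_apply_le_norm (by simp) x i

end TildeMap

/-! ### Bijectivity of `T̃` and invertibility modulo compact operators -/

section Fredholm

variable {ι : Type*} (U : Ultrafilter ι) {X : Type*} [NormedAddCommGroup X] [NormedSpace ℂ X]
  {A : X →L[ℂ] X} {f : ι → ℕ}

/-- Injectivity in sequential form: the class of `g ∘ f` in `X̃` is killed by `Ã`, hence is zero. -/
theorem exists_tendsto_of_injective_tildeMap (hA : Function.Injective (tildeMap U A))
    (hf : Tendsto f U atTop) {g : ℕ → X} {C : ℝ} (hg : ∀ n, ‖g n‖ ≤ C)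
    (hAg : Tendsto (fun n => A (g n)) atTop (𝓝 0)) : ∃ y, Tendsto (fun i => g (f i)) U (𝓝 y) := by
  refine (mk_mk_eq_zero_iff (𝕜 := ℂ) U (x := seqFamily f g hg)).1 (hA ?_)
  rw [map_zero, tildeMap_mk_mk]
  exact (mk_mk_eq_zero_iff U).2 ⟨0, hAg.comp hf⟩

/-- By Riesz's lemma an infinite-dimensional kernel would contain a bounded 1-separated sequence. -/
theorem finiteDimensional_ker_of_injective_tildeMap (hA : Function.Injective (tildeMap U A))
    (hf : Tendsto f U atTop) : FiniteDimensional ℂ A.ker := by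
  by_contra h
  obtain ⟨C, g, -, hg, hg'⟩ := exists_seq_norm_le_one_le_norm_sub h
  obtain ⟨y, hy⟩ := exists_tendsto_of_injective_tildeMap U hA hf (g := fun n => (g n : X)) hg
    (by simp)
  exact not_tendsto_of_pairwise_one_le_norm_sub U hf (g := fun n => (g n : X)) hg' y hy

/-- If `A` is not bounded below on `M`, unit vectors of `M` with `A (g n) → 0` have a limit along
`U`: a unit vector of `M` in the kernel. -/
theorem exists_antilipschitzWith_of_injective_tildeMap (hA : Function.Injective (tildeMap U A))
    (hf : Tendsto f U atTop) {M : Submodule ℂ X} (hM : IsClosed (M : Set X))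
    (hMA : ∀ x ∈ M, A x = 0 → x = 0) : ∃ K, AntilipschitzWith K (A.comp M.subtypeL) := by
  suffices h : ∃ n : ℕ, ∀ x : M, ‖x‖ ≤ n * ‖A x‖ by
    obtain ⟨n, hn⟩ := h
    exact ⟨n, ContinuousLinearMap.antilipschitz_of_bound _ hn⟩
  by_contra! h
  choose x hx using h
  have hx0 : ∀ n, 0 < ‖x n‖ := fun n => (by positivity : (0 : ℝ) ≤ n * ‖A (x n)‖).trans_lt (hx n)
  set g : ℕ → X := fun n => ((‖x n‖⁻¹ : ℝ) : ℂ) • (x n : X) with hgdef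
  have hg : ∀ n, ‖g n‖ = 1 := fun n => by
    rw [hgdef, norm_smul, Complex.norm_real, norm_inv, norm_norm]
    exact inv_mul_cancel₀ (hx0 n).ne'
  have hAg : Tendsto (fun n => A (g n)) atTop (𝓝 0) := by
    refine squeeze_zero_norm' ?_ (tendsto_inv_atTop_nhds_zero_nat (𝕜 := ℝ))
    -- The bound is `‖A (g n)‖ ≤ n⁻¹`; the index 0 is discarded since there `n⁻¹` is 0.
    filter_upwards [eventually_gt_atTop 0] with n hn
    have hn' : (0 : ℝ) < n := Nat.cast_pos.2 hn
    rw [hgdef, map_smul, norm_smul, Complex.norm_real, norm_inv, norm_norm,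
      inv_mul_le_iff₀ (hx0 n), ← div_eq_mul_inv, le_div_iff₀ hn', mul_comm]
    exact (hx n).le
  obtain ⟨y, hy⟩ := exists_tendsto_of_injective_tildeMap U hA hf (fun n => (hg n).le) hAg
  have hyM : y ∈ M := hM.mem_of_tendsto hy (Eventually.of_forall fun i => M.smul_mem _ (x (f i)).2)
  have hy0 : A y = 0 := tendsto_nhds_unique ((A.continuous.tendsto y).comp hy) (hAg.comp hf)
  have hy1 : ‖y‖ = 1 := tendsto_nhds_unique hy.norm (by simp [hg])
  rw [hMA y hyM hy0, norm_zero] at hy1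
  exact zero_ne_one hy1

/-- Closed range makes the quotient a normed space, so Riesz's lemma applies. Surjectivity corrects
a lifted 1-separated sequence by a family `A (w i)` so that it converges along `U`; the quotient map
does not see the correction. -/
theorem finiteDimensional_quotient_range_of_surjective_tildeMap
    (hA : Function.Surjective (tildeMap U A)) (hf : Tendsto f U atTop)
    (hR : IsClosed (A.range : Set X)) : FiniteDimensional ℂ (X ⧸ A.range) := by
  by_contra h
  obtain ⟨C, g, -, hg, hg'⟩ := exists_seq_norm_le_one_le_norm_sub h
  have hlift : ∀ n, ∃ x : X, Submodule.Quotient.mk x = g n ∧ ‖x‖ < C + 1 := fun n => by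
    obtain ⟨x, hx, hx'⟩ := Submodule.Quotient.norm_mk_lt (g n) one_pos
    exact ⟨x, hx, by linarith [hg n]⟩
  choose x hx hxC using hlift
  obtain ⟨w, hw⟩ := hA (Submodule.Quotient.mk (Submodule.Quotient.mk
    (seqFamily f x fun n => (hxC n).le)))
  obtain ⟨w, rfl⟩ := Submodule.Quotient.mk_surjective _ w
  obtain ⟨w, rfl⟩ := Submodule.Quotient.mk_surjective _ w
  rw [tildeMap_mk_mk, eq_comm, ← sub_eq_zero] at hw
  obtain ⟨y, hy⟩ := (mk_mk_eq_zero_iff U (x := seqFamily f x _ - mapFamily A w)).1 hw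
  refine not_tendsto_of_pairwise_one_le_norm_sub U hf hg' (A.range.mkQL y) ?_
  refine ((A.range.mkQL.continuous.tendsto y).comp hy).congr fun i => ?_
  have h0 : A.range.mkQL (A (w i)) = 0 := (Submodule.Quotient.mk_eq_zero _).2 ⟨w i, rfl⟩
  change A.range.mkQL (x (f i) - A (w i)) = _
  rw [map_sub, h0, sub_zero]
  exact hx (f i)

/-- With `p` a projection onto the kernel and `r` one onto the range, `A` is an isomorphism from
`p.ker` onto its range, and `S` is its inverse after `r`. Then `S A = 1 - p` and `A S = r`. -/
theorem exists_inverse_modulo_compact_of_bijective_tildeMap [CompleteSpace X]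
    (hA : Function.Bijective (tildeMap U A)) (hf : Tendsto f U atTop) :
    ∃ S : X →L[ℂ] X, 1 - S * A ∈ compactIdeal X ∧ 1 - A * S ∈ compactIdeal X := by
  have hker := finiteDimensional_ker_of_injective_tildeMap U hA.1 hf
  obtain ⟨p, hp⟩ := Submodule.ClosedComplemented.of_finiteDimensional A.ker
  have hsub : ∀ x, x - p x ∈ p.ker := fun x => by
    change p (x - p x) = 0
    rw [map_sub, hp, sub_self]
  have hAp : ∀ x, A (p x) = 0 := fun x => (p x).2
  have hMA : ∀ x ∈ p.ker, A x = 0 → x = 0 := fun x hx hx' => by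
    have h1 := hp ⟨x, hx'⟩
    have h2 : p x = 0 := hx
    rw [h2] at h1
    exact (congrArg Subtype.val h1).symm
  obtain ⟨K, hK⟩ := exists_antilipschitzWith_of_injective_tildeMap U hA.1 hf p.isClosed_ker hMA
  have : CompleteSpace p.ker := p.isClosed_ker.completeSpace_coe
  set B : p.ker →L[ℂ] X := A.comp p.ker.subtypeL with hB
  have hrange : (B.range : Set X) = A.range := by
    ext y
    constructor
    · rintro ⟨x, rfl⟩
      exact ⟨x, rfl⟩
    · rintro ⟨x, rfl⟩
      refine ⟨⟨x - p x, hsub x⟩, ?_⟩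
      change A (x - p x) = A x
      rw [map_sub, hAp, sub_zero]
  have hBr : IsClosed (Set.range B) := hK.isClosed_range B.uniformContinuous
  have hAr : IsClosed (A.range : Set X) := hrange ▸ hBr
  have hq := finiteDimensional_quotient_range_of_surjective_tildeMap U hA.2 hf hAr
  obtain ⟨r, hr⟩ := Submodule.ClosedComplemented.of_finiteDimensional_quotient hAr
  let e := B.equivRange hK.injective hBr
  have hBA : B.range = A.range := SetLike.coe_injective hrange
  -- The identity map between two equal submodules.
  let j : A.range →L[ℂ] B.range := A.range.subtypeL.codRestrict _ fun y => hBA.ge y.2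
  let S : X →L[ℂ] X := p.ker.subtypeL.comp (e.symm.toContinuousLinearMap.comp (j.comp r))
  have hAS : ∀ x, A (S x) = r x := fun x =>
    congrArg Subtype.val (e.apply_symm_apply (j (r x)))
  have hSA : ∀ x, S (A x) = x - p x := fun x => by
    have h1 : j (r (A x)) = e ⟨x - p x, hsub x⟩ := by
      apply Subtype.ext
      change (r (A x) : X) = A (x - p x)
      rw [map_sub, hAp, sub_zero]
      exact congrArg Subtype.val (hr ⟨A x, x, rfl⟩)
    change ((e.symm (j (r (A x))) : p.ker) : X) = _
    rw [h1, e.symm_apply_apply]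
  refine ⟨S, ?_, ?_⟩
  · have h : (1 - S * A : X →L[ℂ] X) = A.ker.subtypeL.comp p := by
      ext x
      simp [hSA]
    have := FiniteDimensional.proper ℂ A.ker
    rw [h]
    exact (isCompactOperator_of_locallyCompactSpace_rng A.ker.subtypeL).comp_clm p
  -- `1 - A S = 1 - r` vanishes on the range, so it factors through a finite-dimensional quotient.
  · let g : (X ⧸ A.range) →L[ℂ] X := A.range.liftQL (1 - A * S) (by
      rintro _ ⟨x, rfl⟩
      have := congrArg Subtype.val (hr ⟨A x, x, rfl⟩)
      simp [hAS, this])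
    have := FiniteDimensional.proper ℂ (X ⧸ A.range)
    exact (isCompactOperator_of_locallyCompactSpace_rng g).comp_clm A.range.mkQL

theorem isUnit_mk_calkin_iff {A : X →L[ℂ] X} :
    IsUnit (Ideal.Quotient.mk (compactIdeal X) A) ↔
      ∃ S : X →L[ℂ] X, 1 - S * A ∈ compactIdeal X ∧ 1 - A * S ∈ compactIdeal X := by
  have key : ∀ B : X →L[ℂ] X, Ideal.Quotient.mk (compactIdeal X) B = 1 ↔
      1 - B ∈ compactIdeal X := fun B => by
    rw [eq_comm, ← map_one (Ideal.Quotient.mk (compactIdeal X)), Ideal.Quotient.eq]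
  rw [isUnit_iff_exists]
  constructor
  · rintro ⟨b, h1, h2⟩
    obtain ⟨S, rfl⟩ := Ideal.Quotient.mk_surjective b
    rw [← map_mul] at h1 h2
    exact ⟨S, (key _).1 h2, (key _).1 h1⟩
  · rintro ⟨S, h1, h2⟩
    refine ⟨Ideal.Quotient.mk _ S, ?_, ?_⟩ <;> rw [← map_mul, key]
    exacts [h2, h1]

theorem isUnit_tildeMap_iff [CompleteSpace X] (hU : ¬ CountableInterFilter (U : Filter ι))
    (A : X →L[ℂ] X) :
    IsUnit (tildeMap U A) ↔ IsUnit (Ideal.Quotient.mk (compactIdeal X) A) := by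
  rw [isUnit_mk_calkin_iff]
  constructor
  · intro h
    obtain ⟨f, hf⟩ := exists_tendsto_atTop_of_not_countableInterFilter hU
    refine exists_inverse_modulo_compact_of_bijective_tildeMap U ?_ hf
    obtain ⟨R, h1, h2⟩ := isUnit_iff_exists.1 h
    exact Function.bijective_iff_has_inverse.2 ⟨R, fun x => congrArg (fun L => L x) h2,
      fun x => congrArg (fun L => L x) h1⟩
  · rintro ⟨S, h1, h2⟩
    have key : ∀ B C : X →L[ℂ] X, 1 - B * C ∈ compactIdeal X →
        tildeMap U B * tildeMap U C = 1 := fun B C h => by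
      have := tildeMap_eq_zero U (K := 1 - B * C) h
      rw [tildeMap_sub, tildeMap_one, tildeMap_mul, sub_eq_zero] at this
      exact this.symm
    exact isUnit_iff_exists.2 ⟨tildeMap U S, key _ _ h2, key _ _ h1⟩

/-- The spectrum of `T̃` is the essential spectrum of `T`. -/
theorem spectrum_tildeMap [CompleteSpace X] (hU : ¬ CountableInterFilter (U : Filter ι))
    (T : X →L[ℂ] X) : spectrum ℂ (tildeMap U T) = essentialSpectrum T := by
  ext c
  rw [essentialSpectrum, spectrum.mem_iff, spectrum.mem_iff, ← tildeMap_algebraMap_sub,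
    isUnit_tildeMap_iff U hU, map_sub]
  rfl

end Fredholm

/-! ### AM-compact operators on complex Banach lattices -/

section Lattice

variable {F : Type*} [NormedAddCommGroup F] [Lattice F] [IsOrderedAddMonoid F] [HasSolidNorm F]
  [NormedSpace ℝ F] [IsOrderedModule ℝ F] [CompleteSpace F] {ι : Type*} (U : Ultrafilter ι)

/-- The norm is equivalent to that of the product `F × F`. -/
instance Cx.completeSpace : CompleteSpace (Cx F) := by
  refine Metric.complete_of_cauchySeq_tendsto fun u hu => ?_
  have hcauchy : ∀ φ : Cx F → F, (∀ z w, ‖φ z - φ w‖ ≤ ‖z - w‖) →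
      ∃ a, Tendsto (fun n => φ (u n)) atTop (𝓝 a) := fun φ hφ => by
    have hl : LipschitzWith 1 φ := LipschitzWith.of_dist_le_mul fun z w => by
      simpa [dist_eq_norm] using hφ z w
    exact cauchySeq_tendsto_of_complete (hl.uniformContinuous.comp_cauchySeq hu)
  have him : ∀ z : Cx F, ‖z.im‖ ≤ ‖z‖ := fun z => by
    rw [Cx.norm_def]
    apply norm_le_norm_of_abs_le_abs
    rw [abs_of_nonneg (Cx.modulus_nonneg z)]
    exact Cx.abs_im_le_modulus z
  obtain ⟨a, ha⟩ := hcauchy Cx.re fun z w => Cx.norm_re_le (z - w)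
  obtain ⟨b, hb⟩ := hcauchy Cx.im fun z w => him (z - w)
  refine ⟨Cx.mk a b, tendsto_iff_norm_sub_tendsto_zero.2 ?_⟩
  refine squeeze_zero (fun _ => norm_nonneg _) (fun n => Cx.norm_le_add _) ?_
  simpa using (tendsto_iff_norm_sub_tendsto_zero.1 ha).add (tendsto_iff_norm_sub_tendsto_zero.1 hb)

theorem range_toHull_le_closedOrderIdeal :
    LinearMap.range (toHull ℂ U (Cx F)) ≤ closedOrderIdeal U F := by
  rintro _ ⟨z, rfl⟩
  refine subset_closure ⟨z.modulus, Cx.modulus_nonneg z, fun c => ?_⟩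
  exact mk_le_mk U fun i => Cx.re_smul_le_modulus c z

theorem hullMap_mem_range_toHull {T : Cx F →L[ℂ] Cx F} (hT : IsAMCompact T)
    {z : Hull ℂ U (Cx F)} (hz : z ∈ closedOrderIdeal U F) :
    hullMap U T z ∈ LinearMap.range (toHull ℂ U (Cx F)) := by
  refine (isClosed_range_toHull ℂ U (Cx F)).closure_subset
    (map_mem_closure (hullMap U T).continuous hz ?_)
  rintro z ⟨u, hu, hz⟩
  obtain ⟨x, rfl⟩ := Submodule.Quotient.mk_surjective _ z
  -- Truncation changes `x` only by a null family. Real and imaginary parts are then bounded by `u`,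
  -- so the moduli are at most `u + u`.
  rw [mk_clipFamily U hu x hz, hullMap_mk]
  refine (mk_mem_range_toHull_iff U).2 (exists_tendsto_of_totallyBounded U
    (hT.totallyBounded (u + u) (add_nonneg hu hu)) fun i => ⟨_, ?_, rfl⟩)
  exact (Cx.modulus_le_add _).trans (add_le_add (abs_clip_le hu _) (abs_clip_le hu _))

variable (F) in
/-- The quotient map from `Ẽ` onto `Ě`. -/
def tildeToCheck : Tilde ℂ U (Cx F) →L[ℂ] Check U F :=
  (LinearMap.range (toHull ℂ U (Cx F))).liftQL (closedOrderIdeal U F).mkQL fun _ hz =>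
    (Submodule.Quotient.mk_eq_zero _).2 (range_toHull_le_closedOrderIdeal U hz)

/-- The operator from `Ě` to `Ẽ` induced by an AM-compact operator. -/
def checkToTilde {T : Cx F →L[ℂ] Cx F} (hT : IsAMCompact T) :
    Check U F →L[ℂ] Tilde ℂ U (Cx F) :=
  (closedOrderIdeal U F).liftQL ((LinearMap.range (toHull ℂ U (Cx F))).mkQL.comp (hullMap U T))
    fun _ hz => (Submodule.Quotient.mk_eq_zero _).2 (hullMap_mem_range_toHull U hT hz)

theorem checkToTilde_comp_tildeToCheck {T : Cx F →L[ℂ] Cx F} (hT : IsAMCompact T) :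
    (checkToTilde U hT).comp (tildeToCheck F U) = tildeMap U T :=
  tilde_ext U fun _ => rfl

theorem tildeToCheck_comp_checkToTilde {T : Cx F →L[ℂ] Cx F} (hT : IsAMCompact T) :
    (tildeToCheck F U).comp (checkToTilde U hT) = checkMap U T hT.orderBounded := by
  ext z
  obtain ⟨z, rfl⟩ := Submodule.Quotient.mk_surjective _ z
  rfl

end Lattice

end BanachLattice

end

theorem theoremt {F : Type*} [NormedAddCommGroup F] [Lattice F] [IsOrderedAddMonoid F]
    [HasSolidNorm F] [NormedSpace ℝ F] [IsOrderedModule ℝ F] [CompleteSpace F]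
    {ι : Type*} (U : Ultrafilter ι) (hU : ¬ CountableInterFilter (U : Filter ι))
    (T : BanachLattice.Cx F →L[ℂ] BanachLattice.Cx F) (hT : BanachLattice.IsAMCompact T) :
    BanachLattice.pointSpectrum (BanachLattice.checkMap U T hT.orderBounded) \ {0} =
        BanachLattice.pointSpectrum (BanachLattice.tildeMap U T) \ {0} ∧
      (∀ c : ℂ, c ≠ 0 →
        (Function.Surjective
            (c • ContinuousLinearMap.id ℂ (BanachLattice.Check U F) -
              BanachLattice.checkMap U T hT.orderBounded) ↔
          Function.Surjective
            (c • ContinuousLinearMap.id ℂ (BanachLattice.Tilde ℂ U (BanachLattice.Cx F)) -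
              BanachLattice.tildeMap U T))) ∧
      spectrum ℂ (BanachLattice.checkMap U T hT.orderBounded) \ {0} =
        spectrum ℂ (BanachLattice.tildeMap U T) \ {0} ∧
      spectrum ℂ (BanachLattice.tildeMap U T) \ {0} =
        BanachLattice.essentialSpectrum T \ {0} := by
  -- Replacing the essential spectrum by that of `T̃` makes the last equality reflexive; the other
  -- claims concern `q S` and `S q`.
  rw [← BanachLattice.spectrum_tildeMap U hU, ← BanachLattice.tildeToCheck_comp_checkToTilde U hT,
    ← BanachLattice.checkToTilde_comp_tildeToCheck U hT]
  exact ⟨BanachLattice.pointSpectrum_comp_diff_zero _ _,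
    fun c hc => BanachLattice.surjective_smul_id_sub_comp_iff _ _ hc,
    BanachLattice.spectrum_comp_diff_zero _ _, rfl⟩
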